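/- **Setting.** Consider Featherweight Java (FJ) with class declarations $L=\texttt{class }C\texttt{ extends }D\,\{\bar C\,\bar f;\,K\,\bar M\}$, constructors $K$, methods $M=C_0\;m(\bar C\,\bar x)\{\texttt{return }e;\}$ and expressions $e::=x\mid\texttt{this}\mid e.f\mid e.m(\bar e)\mid\texttt{new }C(\bar e)\mid(C)e$. The predefined class $\mathsf{Object}$ has the constructor signature $\mathsf{Object}.init()$. In both systems below a class is only accepted if $K=C(\bar D'\,\bar g,\bar C\,\bar f)\{\texttt{super}(\bar g);\texttt{this}.\bar f=\bar f\}$. *FJ.* The class table $CT$ of a program $\bar L$ (a list of class declarations) is the set of all clauses $C\texttt{ extends }D$, $C.init(\bar D',\bar C)$, $C.f:C'$, $C.m:\bar C\to C_0$ read off from the declarations in $\bar L$; $<:$ is the reflexive transitive closure of $\texttt{extends}$. $field(f,C)$ and $mtype(m,C)$ return the declaration nearest to $C$ on the way up the hierarchy; $fields(C)$ returns the constructor signature of $C$. Expressions are typed under $\Gamma;CT$ by the usual FJ rules (variable, field access, invocation, object creation, up-, down- and stupid cast). $M$ is OK in $C$ if under $\bar x:\bar C,\texttt{this}:C$ the body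 has a type $E_0<:C_0$, $C\texttt{ extends }D\in CT$, and whenever $mtype(m,D)=\bar D\to D_0$, then $\bar C=\bar D$ and $C_0=D_0$. $L$ is OK if $K$ is as above, $fields(D)=D.init(\bar D')$ and all its methods are OK in $C$. $\vdash\bar L\ \mathrm{OK}$ in FJ if every $L$ in $\bar L$ is OK under the class table of $\bar L$. *Co-contextual FJ.* Class types $T$ are class names or class variables $U$. A requirement is a pair $(r,cond)$, where $r$ is one of $T.\texttt{extends}:T'$, $T.init(\bar T)$, $T.f:T'$, $T.m:\bar T\to T'$, $(T.m:\bar T\to T')_{opt}$, and $cond$ is a set of equations and inequations of class types. Constraints are $T=T'$, $T\ne T'$, $T<:T'$, $T\not<:T'$ and $\bar T=\bar T'\text{ if }cond$ (equality of sequences includes equality of lengths). Context requirements $R$ map variables to class types. $merge_R(R_1,R_2)$ is the union of the bindings, with constraints $R_1(x)=R_2(x)$ for shared $x$. $merge_{CR}(CR_1,CR_2)$ keeps the requirements that have no requirement of the same kind and field or method name on the other side, and replaces each such pair $(r_1,c_1)\in CR_1,(r_2,c_2)\in CR_2$ with receivers $T_1,T_2$ by $(r_1,c_1\cup\{T_1\ne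 T_2\})$, $(r_2,c_2\cup\{T_1\ne T_2\})$, $(r_1,c_1\cup c_2\cup\{T_1=T_2\})$, with the constraint that the types required by $r_1$ and $r_2$ are equal if $T_1=T_2$. Several sets are merged one after the other. The rules generate, with variables $U,\bar U,U',U_c,U_d$ that are fresh throughout the whole derivation: - $x$ (or $\texttt{this}$): type $U$, context requirement $x:U$; - $e.f$: type $U$, new requirement $(T_e.f:U,\emptyset)$; - $e.m(\bar e)$: type $U'$, new requirement $(T_e.m:\bar U\to U',\emptyset)$, constraints $\bar T<:\bar U$ for the argument types $\bar T$; - $\texttt{new }C(\bar e)$: type $C$, new requirement $(C.init(\bar U),\emptyset)$, constraints $\bar T<:\bar U$; - $(C)e$: type $C$, constraints $\{T_e<:C\}$, or $\{C<:T_e,\;C\ne T_e\}$, or $\{C\not<:T_e,\;T_e\not<:C\}$; - a method $C_0\;m(\bar C\,\bar x)\{\texttt{return }e;\}$ with enclosing-class variable $U_c$: constraints $T_e<:C_0$, $C_i=R_e(x_i)$ for $x_i\in\mathrm{dom}(R_e)$ and $U_c=R_e(\texttt{this})$ if $\texttt{this}\in\mathrm{dom}(R_e)$; $R_e$ binds nothing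 else; new requirements $(U_c.\texttt{extends}:U_d,\emptyset)$ and $(U_d.m:\bar C\to C_0,\emptyset)_{opt}$; - a class $C\texttt{ extends }D$ with $K$ as above: new requirement $(D.init(\bar D'),\emptyset)$, constraints $U=C$ for the enclosing-class variables $U$ of its methods. All requirements of subterms and new requirements are merged, and all constraints (of subterms, merging and the rule) are united. Removing from a set of requirements a constructor, field or method declaration of class $C$ adds $T\ne C$ to the condition of each requirement on that member ($init$, $f$, $m$, and likewise $m_{opt}$) with receiver $T$, and yields the constraint that the required types equal the declared ones if $T=C$. Removing $C\texttt{ extends }D$ adds $T\ne C$ to the condition of every requirement that is not a constructor requirement, yields $T'=D\text{ if }T=C$ for each $T.\texttt{extends}:T'$, and adds, for each field, method or optional method requirement with receiver $T$ and condition $cond$, a copy with receiver $D$ and condition $cond\cup\{T=C\}$. Removals are performed one after the other: the classes of the program in an order in which no class comes after its immediate superclass; within a class the methods, fields and constructor before the $\texttt{extends}$ clause; and finally the predefined clause $\mathsf{Object}.init()$. For a substitution $\sigma$ from class variables to class types, $\vdash\bar L\ \mathrm{OK}\mid S$ holds co-contextually if all classes of $\bar L$ have co-contextual derivations, $CR$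 is the merge of their requirements, after the removal of all declarations (in some such order) from $CR$ no requirement is left under $\sigma$, that is, every remaining non-optional requirement has a condition that is false under $\sigma$, and $S$ is the union of the constraints of the classes, of merging and of removal. $\sigma$ is a ground solution if it satisfies every constraint of $S$, where $<:$ is taken relative to $\Sigma=ext(\bar L)=\{(C,D)\mid \texttt{class }C\texttt{ extends }D\{\ldots\}\in\bar L\}$, and maps all class types in $CR$ to class names. **Theorem.** Let $\bar L$ be a list of class declarations with pairwise distinct class names. If $\vdash\bar L\ \mathrm{OK}\mid S$ holds co-contextually (with emptiness taken under $\sigma$) and $\sigma$ is a ground solution of $S$ relative to $\Sigma=ext(\bar L)$, then $\vdash\bar L\ \mathrm{OK}$ holds in FJ. -/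

import Mathlib

namespace CoFJ

/-! ## Syntax of Featherweight Java -/

/-- Class names: the predefined root class `Object` and countably many others. -/
inductive ClassName where
  | object
  | named (n : ℕ)
  deriving DecidableEq

abbrev FieldName := ℕ
abbrev MethodName := ℕ
abbrev ParamName := ℕ

/-- A variable occurrence is the self reference `this` or a method parameter. -/
inductive Var where
  | this
  | param (x : ParamName)
  deriving DecidableEq

/-- `e ::= x | this | e.f | e.m(es) | new C(es) | (C) e`. -/
inductive Expr where
  | var (x : Var)
  | field (e : Expr) (f : FieldName)
  | invk (e : Expr) (m : MethodName) (es : List Expr)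
  | new (C : ClassName) (es : List Expr)
  | cast (C : ClassName) (e : Expr)

/-- `C₀ m(Cs xs) { return e; }`. -/
structure MethodDecl where
  ret : ClassName
  name : MethodName
  params : List (ClassName × ParamName)
  body : Expr

/-- `C(Cs fs) { super(gs); this.f = h; ... }`; `inits` lists the pairs `(f, h)`. -/
structure CtorDecl where
  name : ClassName
  params : List (ClassName × FieldName)
  superArgs : List FieldName
  inits : List (FieldName × FieldName)

/-- `class C extends D { Cs fs; K Ms }`. -/
structure ClassDecl where
  name : ClassName
  super : ClassName
  fields : List (ClassName × FieldName)
  ctor : CtorDecl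
  methods : List MethodDecl

/-- The parameter types of a method. -/
def MethodDecl.paramTypes (M : MethodDecl) : List ClassName := M.params.map Prod.fst

/-- The constructor of `L` has the form
`C(Ds' gs, Cs fs) { super(gs); this.fs = fs }`, where `Cs fs` are the fields declared in `L`
and `Ds'` are the types of the parameters that are passed to `super`. -/
def ClassDecl.CtorShape (L : ClassDecl) (Ds' : List ClassName) : Prop :=
  ∃ gs : List (ClassName × FieldName), gs.map Prod.fst = Ds' ∧
    L.ctor = { name := L.name
               params := gs ++ L.fields
               superArgs := gs.map Prod.snd
               inits := L.fields.map fun p => (p.2, p.2) }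

/-! ## Class tables and the (contextual) typing rules of Featherweight Java -/

/-- The clauses of a class table. -/
inductive Clause where
  | ext (C D : ClassName)
  | ctor (C : ClassName) (Cs : List ClassName)
  | field (C : ClassName) (f : FieldName) (C' : ClassName)
  | method (C : ClassName) (m : MethodName) (Cs : List ClassName) (C' : ClassName)

abbrev ClassTable := Set Clause

def addExt (L : ClassDecl) : ClassTable := {Clause.ext L.name L.super}

def addCtor (L : ClassDecl) : ClassTable := {Clause.ctor L.name (L.ctor.params.map Prod.fst)}

def addFs (L : ClassDecl) : ClassTable := {c | ∃ p ∈ L.fields, c = Clause.field L.name p.2 p.1}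

def addMs (L : ClassDecl) : ClassTable :=
  {c | ∃ M ∈ L.methods, c = Clause.method L.name M.name M.paramTypes M.ret}

/-- The class table assembled from all declarations of a program. -/
def classTable (Ls : List ClassDecl) : ClassTable :=
  {c | ∃ L ∈ Ls, c ∈ addExt L ∪ addCtor L ∪ addFs L ∪ addMs L}

/-- The immediate subclass relation of a class table. -/
def projExt (CT : ClassTable) : ClassName → ClassName → Prop := fun C D => Clause.ext C D ∈ CT

/-- The immediate subclass relation of a list of class declarations. -/
def projExtDecls (Ls : List ClassDecl) : ClassName → ClassName → Prop :=
  fun C D => ∃ L ∈ Ls, L.name = C ∧ L.super = D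

/-- Subtyping of class names relative to an immediate subclass relation. -/
def Subtype (Sig : ClassName → ClassName → Prop) : ClassName → ClassName → Prop :=
  Relation.ReflTransGen Sig

/-- `field(f, C, CT) = C'`: the declaration of `f` that is nearest to `C` on the way up the
class hierarchy has type `C'`. -/
inductive FieldLookup (CT : ClassTable) (f : FieldName) : ClassName → ClassName → Prop where
  | here {C C' : ClassName} : Clause.field C f C' ∈ CT → FieldLookup CT f C C'
  | up {C D C' : ClassName} : (∀ C'', Clause.field C f C'' ∉ CT) → Clause.ext C D ∈ CT →
      FieldLookup CT f D C' → FieldLookup CT f C C'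

/-- `fields(C, CT) = C.init(Ds)`; the predefined class `Object` has no fields. -/
def Fields (CT : ClassTable) (C : ClassName) (Ds : List ClassName) : Prop :=
  Clause.ctor C Ds ∈ CT ∨ (C = ClassName.object ∧ Ds = [])

/-- `mtype(m, C, CT) = Ds → C'`. -/
inductive MType (CT : ClassTable) (m : MethodName) :
    ClassName → List ClassName → ClassName → Prop where
  | here {C : ClassName} {Ds : List ClassName} {C' : ClassName} :
      Clause.method C m Ds C' ∈ CT → MType CT m C Ds C'
  | up {C D : ClassName} {Ds : List ClassName} {C' : ClassName} :
      (∀ Ds' C'', Clause.method C m Ds' C'' ∉ CT) → Clause.ext C D ∈ CT →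
      MType CT m D Ds C' → MType CT m C Ds C'

abbrev Ctx := Var → Option ClassName

mutual

/-- `Γ; CT ⊢ e : C`. -/
inductive HasType (Γ : Ctx) (CT : ClassTable) : Expr → ClassName → Prop where
  | var {x : Var} {C : ClassName} : Γ x = some C → HasType Γ CT (.var x) C
  | field {e : Expr} {f : FieldName} {Ce C : ClassName} :
      HasType Γ CT e Ce → FieldLookup CT f Ce C → HasType Γ CT (.field e f) C
  | invk {e : Expr} {m : MethodName} {es : List Expr} {Ce C : ClassName}
      {Cs Ds : List ClassName} :
      HasType Γ CT e Ce → HasTypes Γ CT es Cs → MType CT m Ce Ds C →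
      List.Forall₂ (Subtype (projExt CT)) Cs Ds → HasType Γ CT (.invk e m es) C
  | new {C : ClassName} {es : List Expr} {Cs Ds : List ClassName} :
      HasTypes Γ CT es Cs → Fields CT C Ds →
      List.Forall₂ (Subtype (projExt CT)) Cs Ds → HasType Γ CT (.new C es) C
  | upCast {C D : ClassName} {e : Expr} :
      HasType Γ CT e D → Subtype (projExt CT) D C → HasType Γ CT (.cast C e) C
  | downCast {C D : ClassName} {e : Expr} :
      HasType Γ CT e D → Subtype (projExt CT) C D → C ≠ D → HasType Γ CT (.cast C e) C
  | stupidCast {C D : ClassName} {e : Expr} :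
      HasType Γ CT e D → ¬ Subtype (projExt CT) C D → ¬ Subtype (projExt CT) D C →
      HasType Γ CT (.cast C e) C

/-- `Γ; CT ⊢ es : Cs`, componentwise. -/
inductive HasTypes (Γ : Ctx) (CT : ClassTable) : List Expr → List ClassName → Prop where
  | nil : HasTypes Γ CT [] []
  | cons {e : Expr} {es : List Expr} {C : ClassName} {Cs : List ClassName} :
      HasType Γ CT e C → HasTypes Γ CT es Cs → HasTypes Γ CT (e :: es) (C :: Cs)

end

/-- The typing context `xs : Cs; this : C` of a method body. -/
def methodCtx (C : ClassName) (params : List (ClassName × ParamName)) : Ctx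
  | .this => some C
  | .param x => (params.find? fun p => p.2 = x).map Prod.fst

/-- `C; CT ⊢ M OK`. -/
def MethodOK (C : ClassName) (CT : ClassTable) (M : MethodDecl) : Prop :=
  ∃ E₀ D : ClassName, HasType (methodCtx C M.params) CT M.body E₀ ∧
    Subtype (projExt CT) E₀ M.ret ∧ Clause.ext C D ∈ CT ∧
    ∀ Ds D₀, MType CT M.name D Ds D₀ → M.paramTypes = Ds ∧ M.ret = D₀

/-- `CT ⊢ L OK`. -/
def ClassOK (CT : ClassTable) (L : ClassDecl) : Prop :=
  ∃ Ds' : List ClassName, L.CtorShape Ds' ∧ Fields CT L.super Ds' ∧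
    ∀ M ∈ L.methods, MethodOK L.name CT M

/-- `⊢ Ls OK` in Featherweight Java. -/
def ProgramOK (Ls : List ClassDecl) : Prop :=
  ∀ L ∈ Ls, ClassOK (classTable Ls) L

/-! ## Class types, conditions, constraints, substitutions -/

abbrev ClassVar := ℕ

/-- `T ::= C | U`. -/
inductive ClassType where
  | name (C : ClassName)
  | var (U : ClassVar)

/-- The equations and inequations that conditions consist of. -/
inductive CondAtom where
  | eq (T T' : ClassType)
  | ne (T T' : ClassType)

/-- A condition is a conjunction of equations and inequations. -/
abbrev Cond := Set CondAtom

/-- Constraints. The conditional equation relates two sequences of class types (of length one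
for a single conditional equation `T = T' if cond`). -/
inductive Constraint where
  | eq (T T' : ClassType)
  | ne (T T' : ClassType)
  | sub (T T' : ClassType)
  | nsub (T T' : ClassType)
  | eqIf (Ts Ts' : List ClassType) (cond : Cond)

/-- Substitutions; `U` is mapped to `var U` where the substitution is undefined. -/
abbrev Subst := ClassVar → ClassType

def ClassType.subst (σ : Subst) : ClassType → ClassType
  | .name C => .name C
  | .var U => σ U

/-- A class type is ground if it is a class name. -/
def ClassType.IsGround (T : ClassType) : Prop := ∃ C, T = .name C

def CondAtom.Sat (σ : Subst) : CondAtom → Prop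
  | .eq T T' => T.subst σ = T'.subst σ
  | .ne T T' => T.subst σ ≠ T'.subst σ

def CondHolds (σ : Subst) (cond : Cond) : Prop := ∀ a ∈ cond, a.Sat σ

/-- Subtyping on class types: both are class names, and in the subtype relation. -/
def TypeSubtype (Sig : ClassName → ClassName → Prop) (T T' : ClassType) : Prop :=
  ∃ C D, T = .name C ∧ T' = .name D ∧ Subtype Sig C D

/-- `(Σ, σ)` satisfies a constraint. -/
def Constraint.Sat (Sig : ClassName → ClassName → Prop) (σ : Subst) : Constraint → Prop
  | .eq T T' => T.subst σ = T'.subst σ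
  | .ne T T' => T.subst σ ≠ T'.subst σ
  | .sub T T' => TypeSubtype Sig (T.subst σ) (T'.subst σ)
  | .nsub T T' => ¬ TypeSubtype Sig (T.subst σ) (T'.subst σ)
  | .eqIf Ts Ts' cond =>
      CondHolds σ cond → Ts.map (ClassType.subst σ) = Ts'.map (ClassType.subst σ)

/-- `σ` solves the constraint set `S` relative to `Σ`. -/
def Solves (Sig : ClassName → ClassName → Prop) (σ : Subst) (S : Set Constraint) : Prop :=
  ∀ s ∈ S, s.Sat Sig σ

/-! ## Context requirements -/

abbrev CtxReqs := Var → Option ClassType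

def CtxReqs.empty : CtxReqs := fun _ => none

def CtxReqs.single (x : Var) (T : ClassType) : CtxReqs := Function.update CtxReqs.empty x (some T)

/-- `R - x`. -/
def CtxReqs.remove (R : CtxReqs) (x : Var) : CtxReqs := Function.update R x none

/-- Merging of two sets of context requirements: all bindings, together with the constraints that
shared variables have equal types. -/
def mergeR (R₁ R₂ : CtxReqs) : CtxReqs × Set Constraint :=
  (fun x => (R₁ x).orElse fun _ => R₂ x,
   {s | ∃ x T₁ T₂, R₁ x = some T₁ ∧ R₂ x = some T₂ ∧ s = .eq T₁ T₂})

def mergeRs : List CtxReqs → CtxReqs × Set Constraint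
  | [] => (CtxReqs.empty, ∅)
  | R :: Rs => ((mergeR R (mergeRs Rs).1).1, (mergeRs Rs).2 ∪ (mergeR R (mergeRs Rs).1).2)

/-! ## Class table requirements -/

/-- Class requirements. -/
inductive ClassReq where
  | ext (T T' : ClassType)
  | ctor (T : ClassType) (Ts : List ClassType)
  | field (T : ClassType) (f : FieldName) (T' : ClassType)
  | method (T : ClassType) (m : MethodName) (Ts : List ClassType) (T' : ClassType)
  | optMethod (T : ClassType) (m : MethodName) (Ts : List ClassType) (T' : ClassType)

/-- What a class requirement asks for, up to its receiver and its types. Two requirements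
potentially overlap if they are of the same kind and, for fields and methods, of the same name. -/
inductive Member where
  | ext
  | ctor
  | field (f : FieldName)
  | method (m : MethodName)
  | optMethod (m : MethodName)

def ClassReq.member : ClassReq → Member
  | .ext _ _ => .ext
  | .ctor _ _ => .ctor
  | .field _ f _ => .field f
  | .method _ m _ _ => .method m
  | .optMethod _ m _ _ => .optMethod m

/-- The receiver of a requirement. -/
def ClassReq.recv : ClassReq → ClassType
  | .ext T _ => T
  | .ctor T _ => T
  | .field T _ _ => T
  | .method T _ _ _ => T
  | .optMethod T _ _ _ => T

/-- The types that a requirement assigns; for methods the return type followed by the parameter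
types. -/
def ClassReq.types : ClassReq → List ClassType
  | .ext _ T' => [T']
  | .ctor _ Ts => Ts
  | .field _ _ T' => [T']
  | .method _ _ Ts T' => T' :: Ts
  | .optMethod _ _ Ts T' => T' :: Ts

/-- The same requirement for another receiver. -/
def ClassReq.withRecv (D : ClassType) : ClassReq → ClassReq
  | .ext _ T' => .ext D T'
  | .ctor _ Ts => .ctor D Ts
  | .field _ f T' => .field D f T'
  | .method _ m Ts T' => .method D m Ts T'
  | .optMethod _ m Ts T' => .optMethod D m Ts T'

/-- The requirements that can also be met by a superclass of the receiver. -/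
def ClassReq.IsInheritable : ClassReq → Prop
  | .ext _ _ => False
  | .ctor _ _ => False
  | .field _ _ _ => True
  | .method _ _ _ _ => True
  | .optMethod _ _ _ _ => True

def ClassReq.IsCtor : ClassReq → Prop
  | .ctor _ _ => True
  | _ => False

def ClassReq.IsOptional : ClassReq → Prop
  | .optMethod _ _ _ _ => True
  | _ => False

/-- Class table requirements: sets of conditional class requirements. -/
abbrev ClassReqs := Set (ClassReq × Cond)

/-- Merging of two sets of class table requirements. Requirements without a potentially overlapping
one on the other side are kept; each potentially overlapping pair gives rise to three conditional
requirements and a conditional equation between the required types. -/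
def mergeCR (CR₁ CR₂ : ClassReqs) : ClassReqs × Set Constraint :=
  ({p | p ∈ CR₁ ∧ ∀ q ∈ CR₂, q.1.member ≠ p.1.member} ∪
   {p | p ∈ CR₂ ∧ ∀ q ∈ CR₁, q.1.member ≠ p.1.member} ∪
   {p | ∃ r₁ c₁ r₂ c₂, (r₁, c₁) ∈ CR₁ ∧ (r₂, c₂) ∈ CR₂ ∧ r₁.member = r₂.member ∧
      (p = (r₁, c₁ ∪ {.ne r₁.recv r₂.recv}) ∨
       p = (r₂, c₂ ∪ {.ne r₁.recv r₂.recv}) ∨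
       p = (r₁, c₁ ∪ c₂ ∪ {.eq r₁.recv r₂.recv}))},
   {s | ∃ r₁ c₁ r₂ c₂, (r₁, c₁) ∈ CR₁ ∧ (r₂, c₂) ∈ CR₂ ∧ r₁.member = r₂.member ∧
      s = .eqIf r₁.types r₂.types {.eq r₁.recv r₂.recv}})

def mergeCRs : List ClassReqs → ClassReqs × Set Constraint
  | [] => (∅, ∅)
  | CR :: CRs =>
      ((mergeCR CR (mergeCRs CRs).1).1, (mergeCRs CRs).2 ∪ (mergeCR CR (mergeCRs CRs).1).2)

/-! ## Removal of requirements -/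

/-- A removal operation turns requirements into new requirements and constraints. -/
abbrev Removal := ClassReqs → ClassReqs × Set Constraint

/-- Applying removal operations one after the other, collecting the constraints. -/
def removeSeq : List Removal → Removal
  | [], CR => (CR, ∅)
  | f :: fs, CR => ((removeSeq fs (f CR).1).1, (f CR).2 ∪ (removeSeq fs (f CR).1).2)

/-- The common form of the removal of a clause of class `C` that declares the member `k` with the
types `Ts`: requirements on `k` are restricted to receivers different from `C`, and required to
agree with `Ts` if their receiver is `C`. -/
def removeMember (C : ClassName) (k : Member) (Ts : List ClassName) : Removal := fun CR =>
  ({p | ∃ r c, (r, c) ∈ CR ∧ r.member = k ∧ p = (r, c ∪ {.ne r.recv (.name C)})} ∪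
   {p | p ∈ CR ∧ p.1.member ≠ k},
   {s | ∃ r c, (r, c) ∈ CR ∧ r.member = k ∧
      s = .eqIf r.types (Ts.map .name) {.eq r.recv (.name C)}})

def removeM (C : ClassName) (M : MethodDecl) : Removal :=
  removeMember C (.method M.name) (M.ret :: M.paramTypes)

def removeOptM (C : ClassName) (M : MethodDecl) : Removal :=
  removeMember C (.optMethod M.name) (M.ret :: M.paramTypes)

def removeF (C : ClassName) (f : ClassName × FieldName) : Removal :=
  removeMember C (.field f.2) [f.1]

def removeCtor (C : ClassName) (Ds : List ClassName) : Removal := removeMember C .ctor Ds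

def removeMs (L : ClassDecl) : Removal := removeSeq (L.methods.map (removeM L.name))

def removeOptMs (L : ClassDecl) : Removal := removeSeq (L.methods.map (removeOptM L.name))

def removeFs (L : ClassDecl) : Removal := removeSeq (L.fields.map (removeF L.name))

/-- Removal of the clause `C extends D`: inheritance, field and method requirements are restricted
to receivers different from `C`, and those on fields and methods are duplicated with receiver `D`
for the case that their receiver is `C`. Constructor requirements are not affected. -/
def removeExt (C D : ClassName) : Removal := fun CR =>
  ({p | p ∈ CR ∧ p.1.IsCtor} ∪
   {p | ∃ r c, (r, c) ∈ CR ∧ ¬ r.IsCtor ∧ p = (r, c ∪ {.ne r.recv (.name C)})} ∪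
   {p | ∃ r c, (r, c) ∈ CR ∧ r.IsInheritable ∧
      p = (r.withRecv (.name D), c ∪ {.eq r.recv (.name C)})},
   {s | ∃ T T' c, (ClassReq.ext T T', c) ∈ CR ∧
      s = .eqIf [T'] [.name D] {.eq T (.name C)}})

/-- Removal of all clauses of a class declaration, the `extends` clause last. -/
def removeClass (L : ClassDecl) : Removal :=
  removeSeq [removeMs L, removeOptMs L, removeFs L,
    removeCtor L.name (L.ctor.params.map Prod.fst), removeExt L.name L.super]

/-- Removal of the clauses of all declarations in the given order, and of the constructor
`Object.init()` of the predefined class. -/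
def removeProgram (Ls : List ClassDecl) : Removal :=
  removeSeq (Ls.map removeClass ++ [removeCtor .object []])

/-- No class is listed after its immediate superclass. -/
def SubclassesFirst (Ls : List ClassDecl) : Prop :=
  Ls.Pairwise fun L₁ L₂ => L₂.super ≠ L₁.name

/-- `σ(CR) = ∅`: the requirements that are left over are optional, or they are discharged because
their condition does not hold under `σ`. -/
def Discharged (σ : Subst) (CR : ClassReqs) : Prop :=
  ∀ p ∈ CR, ¬ p.1.IsOptional → ¬ CondHolds σ p.2

/-! ## Co-contextual typing rules

The last index of each judgment is the set of class variables that were introduced as fresh in the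
derivation; variables introduced in independent derivations are different. -/

/-- The constraints `Ts <: Us`, componentwise. -/
def subConstraints (Ts Us : List ClassType) : Set Constraint :=
  {s | ∃ p ∈ Ts.zip Us, s = .sub p.1 p.2}

mutual

/-- `e : T | S | R | CR`. -/
inductive CoExpr :
    Expr → ClassType → Set Constraint → CtxReqs → ClassReqs → Set ClassVar → Prop where
  | var (x : Var) (U : ClassVar) :
      CoExpr (.var x) (.var U) ∅ (CtxReqs.single x (.var U)) ∅ {U}
  | field {e : Expr} {f : FieldName} {Te : ClassType} {Se : Set Constraint} {Re : CtxReqs}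
      {CRe : ClassReqs} {X : Set ClassVar} {U : ClassVar} {CR : ClassReqs}
      {Sf : Set Constraint} :
      CoExpr e Te Se Re CRe X → U ∉ X →
      mergeCR CRe {(.field Te f (.var U), ∅)} = (CR, Sf) →
      CoExpr (.field e f) (.var U) (Se ∪ Sf) Re CR (X ∪ {U})
  | invk {e : Expr} {m : MethodName} {es : List Expr} {Te : ClassType} {Se : Set Constraint}
      {Re : CtxReqs} {CRe : ClassReqs} {Xe : Set ClassVar} {Ts : List ClassType}
      {Ss : Set Constraint} {Rs : List CtxReqs} {CRs : List ClassReqs} {Xs : Set ClassVar}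
      {Us : List ClassVar} {U' : ClassVar} {R' : CtxReqs} {Sr : Set Constraint}
      {CR' : ClassReqs} {Scr : Set Constraint} :
      CoExpr e Te Se Re CRe Xe → CoExprs es Ts Ss Rs CRs Xs → Disjoint Xe Xs →
      Us.length = es.length → (U' :: Us).Nodup → (∀ U ∈ U' :: Us, U ∉ Xe ∪ Xs) →
      mergeRs (Re :: Rs) = (R', Sr) →
      mergeCRs (CRe :: {(.method Te m (Us.map .var) (.var U'), ∅)} :: CRs) = (CR', Scr) →
      CoExpr (.invk e m es) (.var U')
        (Ss ∪ Se ∪ subConstraints Ts (Us.map .var) ∪ Sr ∪ Scr) R' CR'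
        (Xe ∪ Xs ∪ {U | U ∈ U' :: Us})
  | new {C : ClassName} {es : List Expr} {Ts : List ClassType} {Ss : Set Constraint}
      {Rs : List CtxReqs} {CRs : List ClassReqs} {Xs : Set ClassVar} {Us : List ClassVar}
      {R' : CtxReqs} {Sr : Set Constraint} {CR' : ClassReqs} {Scr : Set Constraint} :
      CoExprs es Ts Ss Rs CRs Xs →
      Us.length = es.length → Us.Nodup → (∀ U ∈ Us, U ∉ Xs) →
      mergeRs Rs = (R', Sr) →
      mergeCRs ({(.ctor (.name C) (Us.map .var), ∅)} :: CRs) = (CR', Scr) →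
      CoExpr (.new C es) (.name C) (Ss ∪ subConstraints Ts (Us.map .var) ∪ Sr ∪ Scr) R' CR'
        (Xs ∪ {U | U ∈ Us})
  | upCast {C : ClassName} {e : Expr} {Te : ClassType} {Se : Set Constraint} {Re : CtxReqs}
      {CRe : ClassReqs} {X : Set ClassVar} :
      CoExpr e Te Se Re CRe X →
      CoExpr (.cast C e) (.name C) (Se ∪ {.sub Te (.name C)}) Re CRe X
  | downCast {C : ClassName} {e : Expr} {Te : ClassType} {Se : Set Constraint} {Re : CtxReqs}
      {CRe : ClassReqs} {X : Set ClassVar} :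
      CoExpr e Te Se Re CRe X →
      CoExpr (.cast C e) (.name C) (Se ∪ {.sub (.name C) Te} ∪ {.ne (.name C) Te}) Re CRe X
  | stupidCast {C : ClassName} {e : Expr} {Te : ClassType} {Se : Set Constraint} {Re : CtxReqs}
      {CRe : ClassReqs} {X : Set ClassVar} :
      CoExpr e Te Se Re CRe X →
      CoExpr (.cast C e) (.name C) (Se ∪ {.nsub (.name C) Te} ∪ {.nsub Te (.name C)}) Re CRe X

/-- Componentwise judgment for a sequence of expressions; the constraint sets are united. -/
inductive CoExprs :
    List Expr → List ClassType → Set Constraint → List CtxReqs → List ClassReqs →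
      Set ClassVar → Prop where
  | nil : CoExprs [] [] ∅ [] [] ∅
  | cons {e : Expr} {T : ClassType} {S : Set Constraint} {R : CtxReqs} {CR : ClassReqs}
      {X : Set ClassVar} {es : List Expr} {Ts : List ClassType} {Ss : Set Constraint}
      {Rs : List CtxReqs} {CRs : List ClassReqs} {Xs : Set ClassVar} :
      CoExpr e T S R CR X → CoExprs es Ts Ss Rs CRs Xs → Disjoint X Xs →
      CoExprs (e :: es) (T :: Ts) (S ∪ Ss) (R :: Rs) (CR :: CRs) (X ∪ Xs)

end

/-- The constraints `C = R(x)` for the parameters `C x` with `x ∈ dom R`. -/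
def paramConstraints (params : List (ClassName × ParamName)) (R : CtxReqs) : Set Constraint :=
  {s | ∃ p ∈ params, ∃ T, R (.param p.2) = some T ∧ s = .eq (.name p.1) T}

/-- The constraint `U = R(this)` if `this ∈ dom R`. -/
def thisConstraints (U : ClassVar) (R : CtxReqs) : Set Constraint :=
  {s | ∃ T, R .this = some T ∧ s = .eq (.var U) T}

/-- `M OK | S | U | CR`. -/
inductive CoMethod :
    MethodDecl → Set Constraint → ClassVar → ClassReqs → Set ClassVar → Prop where
  | mk {M : MethodDecl} {Te : ClassType} {Se : Set Constraint} {Re : CtxReqs} {CRe : ClassReqs}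
      {X : Set ClassVar} {Uc Ud : ClassVar} {CR : ClassReqs} {Scr : Set Constraint} :
      CoExpr M.body Te Se Re CRe X → Uc ∉ X → Ud ∉ X → Uc ≠ Ud →
      (M.params.foldl (fun R p => R.remove (.param p.2)) (Re.remove .this)) = CtxReqs.empty →
      mergeCRs [CRe, {(.ext (.var Uc) (.var Ud), ∅)},
        {(.optMethod (.var Ud) M.name (M.paramTypes.map .name) (.name M.ret), ∅)}] = (CR, Scr) →
      CoMethod M
        (Se ∪ {.sub Te (.name M.ret)} ∪ thisConstraints Uc Re ∪ Scr ∪ paramConstraints M.params Re)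
        Uc CR (X ∪ {Uc, Ud})

/-- Judgments for a sequence of methods; the constraint sets are united. -/
inductive CoMethods :
    List MethodDecl → Set Constraint → List ClassVar → List ClassReqs → Set ClassVar →
      Prop where
  | nil : CoMethods [] ∅ [] [] ∅
  | cons {M : MethodDecl} {S : Set Constraint} {U : ClassVar} {CR : ClassReqs} {X : Set ClassVar}
      {Ms : List MethodDecl} {Ss : Set Constraint} {Us : List ClassVar} {CRs : List ClassReqs}
      {Xs : Set ClassVar} :
      CoMethod M S U CR X → CoMethods Ms Ss Us CRs Xs → Disjoint X Xs →
      CoMethods (M :: Ms) (S ∪ Ss) (U :: Us) (CR :: CRs) (X ∪ Xs)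

/-- `L OK | S | CR`. -/
inductive CoClass : ClassDecl → Set Constraint → ClassReqs → Set ClassVar → Prop where
  | mk {L : ClassDecl} {Ds' : List ClassName} {Ss : Set Constraint} {Us : List ClassVar}
      {CRs : List ClassReqs} {Xs : Set ClassVar} {CR' : ClassReqs} {Scr : Set Constraint} :
      L.CtorShape Ds' → CoMethods L.methods Ss Us CRs Xs →
      mergeCRs ({(.ctor (.name L.super) (Ds'.map .name), ∅)} :: CRs) = (CR', Scr) →
      CoClass L (Ss ∪ {s | ∃ U ∈ Us, s = .eq (.var U) (.name L.name)} ∪ Scr) CR' Xs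

/-- Judgments for a sequence of class declarations; the constraint sets are united. -/
inductive CoClasses :
    List ClassDecl → Set Constraint → List ClassReqs → Set ClassVar → Prop where
  | nil : CoClasses [] ∅ [] ∅
  | cons {L : ClassDecl} {S : Set Constraint} {CR : ClassReqs} {X : Set ClassVar}
      {Ls : List ClassDecl} {Ss : Set Constraint} {CRs : List ClassReqs} {Xs : Set ClassVar} :
      CoClass L S CR X → CoClasses Ls Ss CRs Xs → Disjoint X Xs →
      CoClasses (L :: Ls) (S ∪ Ss) (CR :: CRs) (X ∪ Xs)

/-- `Ls OK | S`, with merged class table requirements `CR'`: the clauses of all declarations are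
removed from `CR'`, subclasses before their superclasses, and under the substitution `σ` no
requirement is left. -/
inductive CoProgramOK (σ : Subst) : List ClassDecl → Set Constraint → ClassReqs → Prop where
  | mk {Ls Ls' : List ClassDecl} {Ss : Set Constraint} {CRs : List ClassReqs} {Xs : Set ClassVar}
      {CR' : ClassReqs} {S' : Set Constraint} {CRf : ClassReqs} {S : Set Constraint} :
      CoClasses Ls Ss CRs Xs → mergeCRs CRs = (CR', S') →
      Ls'.Perm Ls → SubclassesFirst Ls' →
      removeProgram Ls' CR' = (CRf, S) → Discharged σ CRf →
      CoProgramOK σ Ls (Ss ∪ S' ∪ S) CR'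

/-! ## Ground solutions -/

def CondAtom.GroundUnder (σ : Subst) : CondAtom → Prop
  | .eq T T' => (T.subst σ).IsGround ∧ (T'.subst σ).IsGround
  | .ne T T' => (T.subst σ).IsGround ∧ (T'.subst σ).IsGround

/-- `σ(CR)` is ground: all class types in the requirements and in their conditions are mapped to
class names. -/
def GroundUnder (σ : Subst) (CR : ClassReqs) : Prop :=
  ∀ p ∈ CR, (p.1.recv.subst σ).IsGround ∧ (∀ T ∈ p.1.types, (T.subst σ).IsGround) ∧
    ∀ a ∈ p.2, a.GroundUnder σ

/-- `σ` is a ground solution of the constraints `S` relative to `Σ`, for the requirements `CR`. -/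
def GroundSolution (Sig : ClassName → ClassName → Prop) (S : Set Constraint) (CR : ClassReqs)
    (σ : Subst) : Prop :=
  Solves Sig σ S ∧ GroundUnder σ CR

end CoFJ

namespace CoFJ

-- Requirements are read as statements about the class table: under σ, a requirement is valid if
-- lookup in the table answers it with exactly the required types, and an optional one is valid if
-- every answer of `MType` has those types. Three facts then give soundness.
--
-- The removal argument (`ClassReq.valid_of_removed`): if no requirement is left after removing all
-- declarations, each requirement whose condition holds is valid. Such a requirement either meets a
-- declaration in its receiver's class, where the constraints equate the types, or moves on to the
-- superclass just as lookup does, or keeps its receiver. At the end, a mandatory requirement whose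
-- condition still holds can only be one on `Object.init()`, while an optional one has a receiver at
-- which no lookup succeeds. This last point rests on the removal order: an optional requirement
-- must never be redirected to a class already removed.
--
-- The merging argument (`ReqsValid.of_mergeCR`): validity of a merge passes to both parts. The
-- danger is that a requirement is conjoined with the false condition of an overlapping one and is
-- lost. The invariant `Covered` excludes this, since it always offers an overlapping partner whose
-- condition is true. It holds for the unconditional singletons created by the rules and is kept by
-- merging.
--
-- The typing argument (`CoExpr.sound` and its analogues for methods and classes): by induction on
-- the co-contextual derivation, valid requirements and solved constraints supply the premises of
-- the corresponding FJ rule. That σ maps the type of an expression to a class name is part of the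
-- induction.

/-- The class table meets a request for the member `k` with receiver `T` and types `Ts`. -/
def Member.Valid (CT : ClassTable) : Member → ClassType → List ClassType → Prop
  | .ext, T, Ts => ∃ C D, T = .name C ∧ Ts = [.name D] ∧ Clause.ext C D ∈ CT
  | .ctor, T, Ts => ∃ C Ds, T = .name C ∧ Ts = Ds.map .name ∧ Fields CT C Ds
  | .field f, T, Ts => ∃ C D, T = .name C ∧ Ts = [.name D] ∧ FieldLookup CT f C D
  | .method m, T, Ts => ∃ C Ds D, T = .name C ∧ Ts = .name D :: Ds.map .name ∧ MType CT m C Ds D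
  | .optMethod m, T, Ts =>
      ∀ C Ds D, T = .name C → MType CT m C Ds D → Ts = .name D :: Ds.map .name

/-- The class table meets the requirement `r` under `σ`. -/
def ClassReq.Valid (CT : ClassTable) (σ : Subst) (r : ClassReq) : Prop :=
  r.member.Valid CT (r.recv.subst σ) (r.types.map (ClassType.subst σ))

/-- The class table meets all requirements whose conditions hold under `σ`. -/
def ReqsValid (CT : ClassTable) (σ : Subst) (CR : ClassReqs) : Prop :=
  ∀ r c, (r, c) ∈ CR → CondHolds σ c → r.Valid CT σ

/-! ## Conditions and constraints -/

theorem condHolds_empty (σ : Subst) : CondHolds σ ∅ := fun _ h => h.elim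

theorem condHolds_union {σ : Subst} {c d : Cond} :
    CondHolds σ (c ∪ d) ↔ CondHolds σ c ∧ CondHolds σ d :=
  ⟨fun h => ⟨fun a ha => h a (.inl ha), fun a ha => h a (.inr ha)⟩,
    fun h a ha => ha.elim (h.1 a) (h.2 a)⟩

theorem condHolds_ne {σ : Subst} {T T' : ClassType} :
    CondHolds σ {.ne T T'} ↔ T.subst σ ≠ T'.subst σ := by
  simp [CondHolds, CondAtom.Sat]

theorem condHolds_eq {σ : Subst} {T T' : ClassType} :
    CondHolds σ {.eq T T'} ↔ T.subst σ = T'.subst σ := by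
  simp [CondHolds, CondAtom.Sat]

theorem solves_union {Sig : ClassName → ClassName → Prop} {σ : Subst} {S S' : Set Constraint} :
    Solves Sig σ (S ∪ S') ↔ Solves Sig σ S ∧ Solves Sig σ S' :=
  ⟨fun h => ⟨fun a ha => h a (.inl ha), fun a ha => h a (.inr ha)⟩,
    fun h a ha => ha.elim (h.1 a) (h.2 a)⟩

theorem solves_singleton {Sig : ClassName → ClassName → Prop} {σ : Subst} {s : Constraint} :
    Solves Sig σ {s} ↔ s.Sat Sig σ := by
  simp [Solves]

theorem map_subst_name (σ : Subst) (Cs : List ClassName) :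
    (Cs.map ClassType.name).map (ClassType.subst σ) = Cs.map .name := by
  rw [List.map_map]; rfl

theorem map_subst_var (σ : Subst) (Us : List ClassVar) :
    (Us.map ClassType.var).map (ClassType.subst σ) = Us.map σ := by
  rw [List.map_map]; rfl

theorem map_name_inj {Cs Ds : List ClassName}
    (h : Cs.map ClassType.name = Ds.map ClassType.name) : Cs = Ds :=
  List.map_injective_iff.2 (fun _ _ h => ClassType.name.inj h) h

/-! ## Merging -/

/-- Each requirement is accompanied by one on the same member and with the same receiver, whose
condition holds under `σ`. -/
def Covered (σ : Subst) (CR : ClassReqs) : Prop :=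
  ∀ r c, (r, c) ∈ CR → ∃ r' c', (r', c') ∈ CR ∧ r'.member = r.member ∧
    r'.recv.subst σ = r.recv.subst σ ∧ CondHolds σ c'

theorem covered_empty (σ : Subst) : Covered σ ∅ := fun _ _ h => h.elim

theorem covered_singleton (σ : Subst) (r : ClassReq) : Covered σ {(r, ∅)} := by
  intro r' c' h
  obtain ⟨rfl, rfl⟩ := Prod.mk.inj h
  exact ⟨r', ∅, h, rfl, rfl, condHolds_empty σ⟩

section Merge

variable {Sig : ClassName → ClassName → Prop} {σ : Subst} {CT : ClassTable}
  {CR₁ CR₂ : ClassReqs} {r₁ r₂ : ClassReq} {c₁ c₂ : Cond}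

/-- Merging splits `r₁` into a copy for different and a copy for equal receivers. Only the latter
inherits `c₂`, so once `c₂` holds one of the two copies has a true condition. -/
theorem mem_mergeCR_left (h₁ : (r₁, c₁) ∈ CR₁) (h₂ : (r₂, c₂) ∈ CR₂)
    (hm : r₁.member = r₂.member) (hc₁ : CondHolds σ c₁) (hc₂ : CondHolds σ c₂) :
    ∃ c, (r₁, c) ∈ (mergeCR CR₁ CR₂).1 ∧ CondHolds σ c := by
  by_cases he : r₁.recv.subst σ = r₂.recv.subst σ
  · exact ⟨_, .inr ⟨r₁, c₁, r₂, c₂, h₁, h₂, hm, .inr (.inr rfl)⟩,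
      condHolds_union.2 ⟨condHolds_union.2 ⟨hc₁, hc₂⟩, condHolds_eq.2 he⟩⟩
  · exact ⟨_, .inr ⟨r₁, c₁, r₂, c₂, h₁, h₂, hm, .inl rfl⟩,
      condHolds_union.2 ⟨hc₁, condHolds_ne.2 he⟩⟩

/-- Coverage pays off here: an arbitrary overlapping requirement may have a false condition, but it
can be exchanged for one on the same member with a true condition. -/
theorem exists_overlap (hcov : Covered σ CR₂) (h : ¬ ∀ q ∈ CR₂, q.1.member ≠ r₁.member) :
    ∃ r c, (r, c) ∈ CR₂ ∧ r₁.member = r.member ∧ CondHolds σ c := by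
  push Not at h
  obtain ⟨⟨r, c⟩, hq, hm⟩ := h
  obtain ⟨r', c', h', hm', -, hc'⟩ := hcov r c hq
  exact ⟨r', c', h', (hm'.trans hm).symm, hc'⟩

theorem exists_mem_mergeCR_left (h₂ : Covered σ CR₂) (h : (r₁, c₁) ∈ CR₁)
    (hc : CondHolds σ c₁) : ∃ c, (r₁, c) ∈ (mergeCR CR₁ CR₂).1 ∧ CondHolds σ c := by
  by_cases ho : ∀ q ∈ CR₂, q.1.member ≠ r₁.member
  · exact ⟨c₁, .inl (.inl ⟨h, ho⟩), hc⟩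
  · obtain ⟨r, c, hr, hm, hc'⟩ := exists_overlap h₂ ho
    exact mem_mergeCR_left h hr hm hc hc'

/-- A requirement of the right side survives, or its receiver coincides with that of a surviving
requirement of the left side. -/
theorem exists_mem_mergeCR_right (h₁ : Covered σ CR₁) (h : (r₂, c₂) ∈ CR₂)
    (hc : CondHolds σ c₂) :
    ∃ r c, (r, c) ∈ (mergeCR CR₁ CR₂).1 ∧ CondHolds σ c ∧ r.member = r₂.member ∧
      r.recv.subst σ = r₂.recv.subst σ ∧
      (Solves Sig σ (mergeCR CR₁ CR₂).2 →
        r.types.map (ClassType.subst σ) = r₂.types.map (ClassType.subst σ)) := by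
  by_cases ho : ∀ q ∈ CR₁, q.1.member ≠ r₂.member
  · exact ⟨r₂, c₂, .inl (.inr ⟨h, ho⟩), hc, rfl, rfl, fun _ => rfl⟩
  · obtain ⟨r, c, hr, hm, hc'⟩ := exists_overlap h₁ ho
    by_cases he : r.recv.subst σ = r₂.recv.subst σ
    · exact ⟨r, _, .inr ⟨r, c, r₂, c₂, hr, h, hm.symm, .inr (.inr rfl)⟩,
        condHolds_union.2 ⟨condHolds_union.2 ⟨hc', hc⟩, condHolds_eq.2 he⟩, hm.symm, he,
        fun hS => hS _ ⟨r, c, r₂, c₂, hr, h, hm.symm, rfl⟩ (condHolds_eq.2 he)⟩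
    · exact ⟨r₂, _, .inr ⟨r, c, r₂, c₂, hr, h, hm.symm, .inr (.inl rfl)⟩,
        condHolds_union.2 ⟨hc, condHolds_ne.2 he⟩, rfl, rfl, fun _ => rfl⟩

/-- Every merged requirement stems from one of the two sides. Its covering requirement on that side
has a true condition and hence a representative in the merge. -/
theorem Covered.mergeCR (h₁ : Covered σ CR₁) (h₂ : Covered σ CR₂) :
    Covered σ (CoFJ.mergeCR CR₁ CR₂).1 := by
  have left : ∀ r c, (r, c) ∈ CR₁ → ∃ r' c', (r', c') ∈ (CoFJ.mergeCR CR₁ CR₂).1 ∧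
      r'.member = r.member ∧ r'.recv.subst σ = r.recv.subst σ ∧ CondHolds σ c' := by
    intro r c hr
    obtain ⟨r', c', hr', hm, he, hc⟩ := h₁ r c hr
    obtain ⟨d, hd, hcd⟩ := exists_mem_mergeCR_left h₂ hr' hc
    exact ⟨r', d, hd, hm, he, hcd⟩
  have right : ∀ r c, (r, c) ∈ CR₂ → ∃ r' c', (r', c') ∈ (CoFJ.mergeCR CR₁ CR₂).1 ∧
      r'.member = r.member ∧ r'.recv.subst σ = r.recv.subst σ ∧ CondHolds σ c' := by
    intro r c hr
    obtain ⟨r', c', hr', hm, he, hc⟩ := h₂ r c hr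
    -- The relation `Sig` occurs only in the discarded statement about types, so any choice serves.
    obtain ⟨s, d, hs, hd, hm', he', -⟩ :=
      exists_mem_mergeCR_right (Sig := fun _ _ => False) h₁ hr' hc
    exact ⟨s, d, hs, hm'.trans hm, he'.trans he, hd⟩
  rintro r c ((⟨h, -⟩ | ⟨h, -⟩) | ⟨s₁, d₁, s₂, d₂, hs₁, hs₂, -, h | h | h⟩)
  · exact left r c h
  · exact right r c h
  all_goals obtain ⟨rfl, -⟩ := Prod.mk.inj h
  · exact left _ _ hs₁
  · exact right _ _ hs₂
  · exact left _ _ hs₁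

/-- Validity depends only on the member and on the receiver and types under σ. A right-hand
requirement absorbed by a left-hand one is therefore valid as soon as its representative is. -/
theorem ReqsValid.of_mergeCR (h₁ : Covered σ CR₁) (h₂ : Covered σ CR₂)
    (hS : Solves Sig σ (mergeCR CR₁ CR₂).2) (h : ReqsValid CT σ (mergeCR CR₁ CR₂).1) :
    ReqsValid CT σ CR₁ ∧ ReqsValid CT σ CR₂ := by
  refine ⟨fun r c hr hc => ?_, fun r c hr hc => ?_⟩
  · obtain ⟨d, hd, hcd⟩ := exists_mem_mergeCR_left h₂ hr hc
    exact h r d hd hcd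
  · obtain ⟨s, d, hs, hd, hm, he, ht⟩ := exists_mem_mergeCR_right (Sig := Sig) h₁ hr hc
    have := h s d hs hd
    rwa [ClassReq.Valid, hm, he, ht hS] at this

theorem covered_mergeCRs {CRs : List ClassReqs} (h : ∀ CR ∈ CRs, Covered σ CR) :
    Covered σ (mergeCRs CRs).1 := by
  induction CRs with
  | nil => exact covered_empty σ
  | cons CR CRs ih =>
    rw [List.forall_mem_cons] at h
    exact h.1.mergeCR (ih h.2)

theorem ReqsValid.of_mergeCRs {CRs : List ClassReqs} (hcov : ∀ CR ∈ CRs, Covered σ CR)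
    (hS : Solves Sig σ (mergeCRs CRs).2) (h : ReqsValid CT σ (mergeCRs CRs).1) :
    ∀ CR ∈ CRs, ReqsValid CT σ CR := by
  induction CRs with
  | nil => simp
  | cons CR CRs ih =>
    rw [List.forall_mem_cons] at hcov ⊢
    have hS := solves_union.1 hS
    have := ReqsValid.of_mergeCR hcov.1 (covered_mergeCRs hcov.2) hS.2 h
    exact ⟨this.1, ih hcov.2 hS.1 this.2⟩

-- Context requirements under merging

/-- The typing context provides the types that the context requirements ask for. -/
def CtxReqs.Meets (σ : Subst) (Γ : Ctx) (R : CtxReqs) : Prop :=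
  ∀ x T, R x = some T → ∃ C, Γ x = some C ∧ T.subst σ = .name C

theorem CtxReqs.Meets.of_mergeR {Γ : Ctx} {R₁ R₂ : CtxReqs}
    (hS : Solves Sig σ (mergeR R₁ R₂).2) (h : (mergeR R₁ R₂).1.Meets σ Γ) :
    R₁.Meets σ Γ ∧ R₂.Meets σ Γ := by
  refine ⟨fun x T hx => h x T (by simp [mergeR, hx]), fun x T hx => ?_⟩
  -- Merging prefers the binding of `R₁`; for a shared variable the generated equation carries the
  -- type over to `R₂`.
  cases h₁ : R₁ x with
  | none => exact h x T (by simp [mergeR, hx, h₁])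
  | some T₁ =>
    obtain ⟨C, hC, hT⟩ := h x T₁ (by simp [mergeR, h₁])
    have he : T₁.subst σ = T.subst σ := hS (.eq T₁ T) ⟨x, T₁, T, h₁, hx, rfl⟩
    exact ⟨C, hC, he ▸ hT⟩

theorem CtxReqs.Meets.of_mergeRs {Γ : Ctx} {Rs : List CtxReqs}
    (hS : Solves Sig σ (mergeRs Rs).2) (h : (mergeRs Rs).1.Meets σ Γ) :
    ∀ R ∈ Rs, R.Meets σ Γ := by
  induction Rs with
  | nil => simp
  | cons R Rs ih =>
    rw [List.forall_mem_cons]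
    have hS := solves_union.1 hS
    have := CtxReqs.Meets.of_mergeR hS.2 h
    exact ⟨this.1, ih hS.1 this.2⟩

end Merge

/-! ## Removal -/

/-- The removal `f` handles the members in `K` of class `C`: requirements on them are compared with
the types in `K` if their receiver is `C`, and all other requirements are preserved. -/
def Removal.Handles (Sig : ClassName → ClassName → Prop) (σ : Subst) (C : ClassName)
    (K : Set (Member × List ClassName)) (f : Removal) : Prop :=
  ∀ CR, Solves Sig σ (f CR).2 → ∀ r c, (r, c) ∈ CR →
    (∀ Ts, (r.member, Ts) ∈ K → r.recv.subst σ = .name C →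
      r.types.map (ClassType.subst σ) = Ts.map .name) ∧
    ∃ c', (r, c') ∈ (f CR).1 ∧
      (CondHolds σ c → (r.recv.subst σ = .name C → ∀ Ts, (r.member, Ts) ∉ K) → CondHolds σ c')

section Remove

variable {Sig : ClassName → ClassName → Prop} {σ : Subst} {C : ClassName}

theorem handles_removeMember (k : Member) (Ts : List ClassName) :
    (removeMember C k Ts).Handles Sig σ C {(k, Ts)} := by
  intro CR hS r c hr
  refine ⟨fun Ts' hk he => ?_, ?_⟩
  · obtain ⟨hk', rfl⟩ := Prod.mk.inj hk
    rw [← map_subst_name σ]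
    exact hS _ ⟨r, c, hr, hk', rfl⟩ (condHolds_eq.2 he)
  · by_cases hk : r.member = k
    · refine ⟨_, .inl ⟨r, c, hr, hk, rfl⟩, fun hc hn =>
        condHolds_union.2 ⟨hc, condHolds_ne.2 fun he => hn he Ts (by simp [hk])⟩⟩
    · exact ⟨c, .inr ⟨hr, hk⟩, fun hc _ => hc⟩

/-- Handling composes because a requirement stays in the set with some condition, true or not. Later
removals thus still see it and compare its types. -/
theorem Removal.Handles.cons {K K' : Set (Member × List ClassName)} {f : Removal}
    {fs : List Removal} (h : f.Handles Sig σ C K)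
    (h' : Removal.Handles Sig σ C K' (removeSeq fs)) :
    Removal.Handles Sig σ C (K ∪ K') (removeSeq (f :: fs)) := by
  intro CR hS r c hr
  have hS := solves_union.1 hS
  obtain ⟨ht, c₁, hr₁, hc₁⟩ := h CR hS.1 r c hr
  obtain ⟨ht', c₂, hr₂, hc₂⟩ := h' _ hS.2 r c₁ hr₁
  exact ⟨fun Ts hk => hk.elim (ht Ts) (ht' Ts), c₂, hr₂, fun hc hn =>
    hc₂ (hc₁ hc fun he Ts hk => hn he Ts (.inl hk)) fun he Ts hk => hn he Ts (.inr hk)⟩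

theorem handles_removeSeq_nil : Removal.Handles Sig σ C ∅ (removeSeq []) :=
  fun _ _ _ c hr => ⟨fun _ h => h.elim, c, hr, fun hc _ => hc⟩

theorem handles_removeSeq_map {α : Type*} (xs : List α) (k : α → Member)
    (Ts : α → List ClassName) :
    Removal.Handles Sig σ C {p | ∃ x ∈ xs, p = (k x, Ts x)}
      (removeSeq (xs.map fun x => removeMember C (k x) (Ts x))) := by
  induction xs with
  | nil =>
    convert handles_removeSeq_nil using 1
    · simp
    · rfl
  | cons x xs ih =>
    convert (handles_removeMember (k x) (Ts x)).cons ih using 1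
    · ext p; simp
    · rfl

end Remove

-- Removal of a whole class

/-- The members declared by a class, with their types. -/
def ClassDecl.members (L : ClassDecl) : Set (Member × List ClassName) :=
  {p | ∃ M ∈ L.methods, p = (.method M.name, M.ret :: M.paramTypes)} ∪
  ({p | ∃ M ∈ L.methods, p = (.optMethod M.name, M.ret :: M.paramTypes)} ∪
  ({p | ∃ q ∈ L.fields, p = (.field q.2, [q.1])} ∪
  ({(.ctor, L.ctor.params.map Prod.fst)} ∪ ∅)))

/-- The nested unions and the trailing `∅` in `ClassDecl.members` are exactly what repeated use of
`Removal.Handles.cons` produces. -/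
theorem handles_removeMembers (Sig : ClassName → ClassName → Prop) (σ : Subst) (L : ClassDecl) :
    Removal.Handles Sig σ L.name L.members (removeSeq [removeMs L, removeOptMs L, removeFs L,
      removeCtor L.name (L.ctor.params.map Prod.fst)]) :=
  .cons (handles_removeSeq_map _ _ _) <| .cons (handles_removeSeq_map _ _ _) <|
    .cons (handles_removeSeq_map _ _ _) <| .cons (handles_removeMember _ _) handles_removeSeq_nil

theorem removeSeq_append (fs gs : List Removal) (CR : ClassReqs) :
    (removeSeq (fs ++ gs) CR).1 = (removeSeq gs (removeSeq fs CR).1).1 ∧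
    (removeSeq (fs ++ gs) CR).2 = (removeSeq fs CR).2 ∪ (removeSeq gs (removeSeq fs CR).1).2 := by
  induction fs generalizing CR with
  | nil => simp [removeSeq]
  | cons f fs ih => simp [removeSeq, ih, Set.union_assoc]

theorem ClassReq.recv_withRecv (D : ClassType) (r : ClassReq) : (r.withRecv D).recv = D := by
  cases r <;> rfl

theorem ClassReq.isOptional_withRecv (D : ClassType) (r : ClassReq) :
    (r.withRecv D).IsOptional ↔ r.IsOptional := by
  cases r <;> rfl

section RemoveClass

variable {Sig : ClassName → ClassName → Prop} {σ : Subst} {L : ClassDecl} {CR : ClassReqs}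
  {r : ClassReq} {c : Cond}

/-- Separates the final `removeExt`, which redirects requirements and so is not of the form
`removeMember`; `CR'` is the set on which it acts. -/
theorem removeClass_spec (hS : Solves Sig σ (removeClass L CR).2) (hr : (r, c) ∈ CR) :
    (∀ Ts, (r.member, Ts) ∈ L.members → r.recv.subst σ = .name L.name →
      r.types.map (ClassType.subst σ) = Ts.map .name) ∧
    ∃ CR' c', (r, c') ∈ CR' ∧ Solves Sig σ (removeExt L.name L.super CR').2 ∧
      (removeClass L CR).1 = (removeExt L.name L.super CR').1 ∧
      (CondHolds σ c → (r.recv.subst σ = .name L.name → ∀ Ts, (r.member, Ts) ∉ L.members) →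
        CondHolds σ c') := by
  have happ := removeSeq_append [removeMs L, removeOptMs L, removeFs L,
    removeCtor L.name (L.ctor.params.map Prod.fst)] [removeExt L.name L.super] CR
  rw [show removeClass L = removeSeq ([removeMs L, removeOptMs L, removeFs L,
    removeCtor L.name (L.ctor.params.map Prod.fst)] ++ [removeExt L.name L.super]) from rfl]
    at hS ⊢
  rw [happ.2, solves_union] at hS
  obtain ⟨ht, c', hr', hc'⟩ := handles_removeMembers Sig σ L CR hS.1 r c hr
  exact ⟨ht, _, c', hr', (solves_union.1 hS.2).1, happ.1, hc'⟩

theorem exists_mem_removeClass_of_ne (hS : Solves Sig σ (removeClass L CR).2) (hr : (r, c) ∈ CR)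
    (hc : CondHolds σ c) (hne : r.recv.subst σ ≠ .name L.name) :
    ∃ c', (r, c') ∈ (removeClass L CR).1 ∧ CondHolds σ c' := by
  obtain ⟨-, CR', c', hr', -, he, hc'⟩ := removeClass_spec hS hr
  have hc' := hc' hc fun h => (hne h).elim
  rw [he]
  by_cases h : r.IsCtor
  · exact ⟨c', .inl (.inl ⟨hr', h⟩), hc'⟩
  · exact ⟨_, .inl (.inr ⟨r, c', hr', h, rfl⟩), condHolds_union.2 ⟨hc', condHolds_ne.2 hne⟩⟩

theorem exists_mem_removeClass_super (hS : Solves Sig σ (removeClass L CR).2) (hr : (r, c) ∈ CR)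
    (hc : CondHolds σ c) (he : r.recv.subst σ = .name L.name) (hi : r.IsInheritable)
    (hm : ∀ Ts, (r.member, Ts) ∉ L.members) :
    ∃ c', (r.withRecv (.name L.super), c') ∈ (removeClass L CR).1 ∧ CondHolds σ c' := by
  obtain ⟨-, CR', c', hr', -, heq, hc'⟩ := removeClass_spec hS hr
  rw [heq]
  exact ⟨_, .inr ⟨r, c', hr', hi, rfl⟩,
    condHolds_union.2 ⟨hc' hc fun _ => hm, condHolds_eq.2 he⟩⟩

/-- No truth of `c` is needed: the equation for the superclass is generated for each inheritance
requirement whatever its condition. -/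
theorem removeClass_ext {T T' : ClassType} (hS : Solves Sig σ (removeClass L CR).2)
    (hr : (.ext T T', c) ∈ CR) (he : T.subst σ = .name L.name) :
    T'.subst σ = .name L.super := by
  obtain ⟨-, CR', c', hr', hS', -⟩ := removeClass_spec hS hr
  simpa [ClassType.subst] using hS' _ ⟨T, T', c', hr', rfl⟩ (condHolds_eq.2 he)

end RemoveClass

/-! ## Class tables -/

section Table

variable {Ls : List ClassDecl}

theorem ext_mem_classTable {C D : ClassName} :
    Clause.ext C D ∈ classTable Ls ↔ projExtDecls Ls C D := by
  simp [classTable, projExtDecls, addExt, addCtor, addFs, addMs, eq_comm]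

theorem ctor_mem_classTable {C : ClassName} {Ds : List ClassName} :
    Clause.ctor C Ds ∈ classTable Ls ↔ ∃ L ∈ Ls, L.name = C ∧ (.ctor, Ds) ∈ L.members := by
  simp [classTable, ClassDecl.members, addExt, addCtor, addFs, addMs, eq_comm]

theorem field_mem_classTable {C D : ClassName} {f : FieldName} :
    Clause.field C f D ∈ classTable Ls ↔
      ∃ L ∈ Ls, L.name = C ∧ (.field f, [D]) ∈ L.members := by
  simp [classTable, ClassDecl.members, addExt, addCtor, addFs, addMs]
  grind

theorem method_mem_classTable {C D : ClassName} {m : MethodName} {Ds : List ClassName} :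
    Clause.method C m Ds D ∈ classTable Ls ↔
      ∃ L ∈ Ls, L.name = C ∧ (.method m, D :: Ds) ∈ L.members := by
  simp [classTable, ClassDecl.members, addExt, addCtor, addFs, addMs]
  grind

theorem optMethod_mem_members {L : ClassDecl} {m : MethodName} {Ts : List ClassName} :
    (.optMethod m, Ts) ∈ L.members ↔ (.method m, Ts) ∈ L.members := by
  simp [ClassDecl.members]

theorem eq_of_name_eq (hn : (Ls.map ClassDecl.name).Nodup) {L L' : ClassDecl} (hL : L ∈ Ls)
    (hL' : L' ∈ Ls) (h : L.name = L'.name) : L = L' :=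
  List.inj_on_of_nodup_map hn hL hL' h

/-- Makes an optional requirement vacuous when its receiver is none of the program's classes. -/
theorem MType.exists_decl {m : MethodName} {C D : ClassName} {Ds : List ClassName}
    (h : MType (classTable Ls) m C Ds D) : ∃ L ∈ Ls, L.name = C := by
  cases h with
  | here h => obtain ⟨L, hL, hC, -⟩ := method_mem_classTable.1 h; exact ⟨L, hL, hC⟩
  | up _ h _ => obtain ⟨L, hL, hC, -⟩ := ext_mem_classTable.1 h; exact ⟨L, hL, hC⟩

/-- A class that is its own superclass inherits no methods. -/
theorem MType.declared_of_self_super {CT : ClassTable} {m : MethodName} {C D : ClassName}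
    {Ds : List ClassName} (h : MType CT m C Ds D) (hC : ∀ E, Clause.ext C E ∈ CT → E = C) :
    Clause.method C m Ds D ∈ CT := by
  induction h with
  | here h => exact h
  | up hn h _ ih =>
    obtain rfl := hC _ h
    exact ih hC

theorem members_method_cons {L : ClassDecl} {m : MethodName} {Ts : List ClassName}
    (h : (.method m, Ts) ∈ L.members) : ∃ D Ds, Ts = D :: Ds := by
  simp [ClassDecl.members] at h
  grind

theorem members_field_singleton {L : ClassDecl} {f : FieldName} {Ts : List ClassName}
    (h : (.field f, Ts) ∈ L.members) : ∃ D, Ts = [D] := by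
  simp [ClassDecl.members] at h
  grind

-- Validity at a class and at its superclass

variable {L : ClassDecl} {σ : Subst} {r : ClassReq}

theorem ClassReq.valid_of_declared (hn : (Ls.map ClassDecl.name).Nodup) (hL : L ∈ Ls)
    (he : r.recv.subst σ = .name L.name) {Ts : List ClassName} (hm : (r.member, Ts) ∈ L.members)
    (ht : ∀ Ts, (r.member, Ts) ∈ L.members →
      r.types.map (ClassType.subst σ) = Ts.map .name) :
    r.Valid (classTable Ls) σ := by
  have hTs := ht Ts hm
  cases r with
  | ext => simp [ClassReq.member, ClassDecl.members] at hm
  | ctor => exact ⟨L.name, Ts, he, hTs, .inl (ctor_mem_classTable.2 ⟨L, hL, rfl, hm⟩)⟩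
  | field T f T' =>
    obtain ⟨D, rfl⟩ := members_field_singleton hm
    exact ⟨L.name, D, he, hTs, .here (field_mem_classTable.2 ⟨L, hL, rfl, hm⟩)⟩
  | method T m Us T' =>
    obtain ⟨D, Ds, rfl⟩ := members_method_cons hm
    exact ⟨L.name, Ds, D, he, hTs, .here (method_mem_classTable.2 ⟨L, hL, rfl, hm⟩)⟩
  -- A class may declare `m` several times, and `MType` may return any of these declarations; hence
  -- `ht` is assumed for all declared types, not just for `Ts`.
  | optMethod T m Us T' =>
    rintro C Ds D hC hD
    obtain rfl := ClassType.name.inj (he.symm.trans hC)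
    cases hD with
    | here h =>
      obtain ⟨L', hL', hname, hm'⟩ := method_mem_classTable.1 h
      obtain rfl := eq_of_name_eq hn hL' hL hname
      exact ht (D :: Ds) (optMethod_mem_members.2 hm')
    | up h _ _ =>
      have hm := optMethod_mem_members.1 hm
      obtain ⟨D', Ds', rfl⟩ := members_method_cons hm
      exact (h Ds' D' (method_mem_classTable.2 ⟨L, hL, rfl, hm⟩)).elim

theorem method_notMem_classTable (hn : (Ls.map ClassDecl.name).Nodup) (hL : L ∈ Ls)
    {m : MethodName} (hm : ∀ Ts, (.method m, Ts) ∉ L.members) (Ds : List ClassName)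
    (D : ClassName) : Clause.method L.name m Ds D ∉ classTable Ls := by
  intro h
  obtain ⟨L', hL', hname, hm'⟩ := method_mem_classTable.1 h
  obtain rfl := eq_of_name_eq hn hL' hL hname
  exact hm _ hm'

theorem super_eq_of_ext_mem (hn : (Ls.map ClassDecl.name).Nodup) (hL : L ∈ Ls) {D : ClassName}
    (h : Clause.ext L.name D ∈ classTable Ls) : D = L.super := by
  obtain ⟨L', hL', hname, rfl⟩ := ext_mem_classTable.1 h
  rw [eq_of_name_eq hn hL' hL hname]

/-- Without a declaration in `L`, lookup at `L` must step to the superclass. Distinct class names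
ensure that no other declaration contributes clauses for `L.name`, and for optional requirements
that the superclass found by lookup is `L.super`. -/
theorem ClassReq.valid_of_super (hn : (Ls.map ClassDecl.name).Nodup) (hL : L ∈ Ls)
    (he : r.recv.subst σ = .name L.name) (hi : r.IsInheritable)
    (hm : ∀ Ts, (r.member, Ts) ∉ L.members)
    (h : (r.withRecv (.name L.super)).Valid (classTable Ls) σ) : r.Valid (classTable Ls) σ := by
  have hext : Clause.ext L.name L.super ∈ classTable Ls :=
    ext_mem_classTable.2 ⟨L, hL, rfl, rfl⟩
  cases r with
  | ext => exact hi.elim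
  | ctor => exact hi.elim
  | field T f T' =>
    obtain ⟨C, D, hC, hTs, hl⟩ := h
    obtain rfl := ClassType.name.inj hC
    refine ⟨L.name, D, he, hTs, .up (fun C'' h => ?_) hext hl⟩
    obtain ⟨L', hL', hname, hm'⟩ := field_mem_classTable.1 h
    obtain rfl := eq_of_name_eq hn hL' hL hname
    exact hm _ hm'
  | method T m Us T' =>
    obtain ⟨C, Ds, D, hC, hTs, hl⟩ := h
    obtain rfl := ClassType.name.inj hC
    exact ⟨L.name, Ds, D, he, hTs, .up (method_notMem_classTable hn hL hm) hext hl⟩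
  | optMethod T m Us T' =>
    rintro C Ds D hC hD
    obtain rfl := ClassType.name.inj (he.symm.trans hC)
    have hm' := method_notMem_classTable hn hL fun Ts h => hm Ts (optMethod_mem_members.2 h)
    cases hD with
    | here h => exact (hm' _ _ h).elim
    | up _ hE hl =>
      obtain rfl := super_eq_of_ext_mem hn hL hE
      exact h _ _ _ rfl hl

theorem ClassReq.valid_of_self_super (hn : (Ls.map ClassDecl.name).Nodup) (hL : L ∈ Ls)
    (he : r.recv.subst σ = .name L.name) (ho : r.IsOptional)
    (hm : ∀ Ts, (r.member, Ts) ∉ L.members) (hs : L.super = L.name) :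
    r.Valid (classTable Ls) σ := by
  cases r with
  | optMethod T m Us T' =>
    rintro C Ds D hC hD
    obtain rfl := ClassType.name.inj (he.symm.trans hC)
    exact (method_notMem_classTable hn hL (fun Ts h => hm Ts (optMethod_mem_members.2 h)) _ _
      (hD.declared_of_self_super fun E hE => (super_eq_of_ext_mem hn hL hE).trans hs)).elim
  | _ => exact ho.elim

end Table

-- Complete removal implies validity

/-- If the removal of the declarations `rest` leaves no requirement, then all requirements are met
by the class table, where optional ones must not refer to the classes `pre` removed before. -/
theorem ClassReq.valid_of_removed {Ls : List ClassDecl} (hn : (Ls.map ClassDecl.name).Nodup)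
    {Sig : ClassName → ClassName → Prop} {σ : Subst} (rest pre : List ClassDecl)
    (hp : (pre ++ rest).Perm Ls) (ho : SubclassesFirst (pre ++ rest)) (CR : ClassReqs)
    (hS : Solves Sig σ (removeProgram rest CR).2)
    (hd : Discharged σ (removeProgram rest CR).1) {r : ClassReq} {c : Cond} (hr : (r, c) ∈ CR)
    (hc : CondHolds σ c)
    (hopt : r.IsOptional → ∀ L ∈ pre, r.recv.subst σ ≠ .name L.name) :
    r.Valid (classTable Ls) σ := by
  induction rest generalizing pre CR r c with
  | nil =>
    by_cases h : r.IsOptional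
    · cases r with
      | optMethod T m Us T' =>
        rintro C Ds D hC hD
        obtain ⟨L, hL, rfl⟩ := hD.exists_decl
        exact (hopt h L (by simpa using hp.symm.subset hL) hC).elim
      | _ => exact h.elim
    · obtain ⟨ht, c', hr', hc'⟩ := handles_removeMember .ctor [] CR (solves_union.1 hS).1 r c hr
      -- A mandatory requirement has a false condition at the end, so the removal of `Object.init()`
      -- must have falsified it.
      have : ¬ (r.recv.subst σ = .name .object → ∀ Ts, (r.member, Ts) ∉ _) :=
        fun hn => hd _ hr' h (hc' hc hn)
      push Not at this
      obtain ⟨he, Ts, hm⟩ := this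
      have ht := ht Ts hm he
      obtain ⟨hm', rfl⟩ := Prod.mk.inj hm
      rw [ClassReq.Valid, hm']
      exact ⟨.object, [], he, ht, .inr ⟨rfl, rfl⟩⟩
  | cons L rest ih =>
    have hL : L ∈ Ls := hp.subset (by simp)
    have hS' := solves_union.1 hS
    have next {r c} := ih (r := r) (c := c) (pre ++ [L]) (by simpa using hp) (by simpa using ho) (removeClass L CR).1
      hS'.2 hd
    by_cases he : r.recv.subst σ = .name L.name
    · by_cases hm : ∃ Ts, (r.member, Ts) ∈ L.members
      · obtain ⟨Ts, hm⟩ := hm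
        exact valid_of_declared hn hL he hm fun Ts h => (removeClass_spec hS'.1 hr).1 Ts h he
      push Not at hm
      by_cases hi : r.IsInheritable
      -- `SubclassesFirst` compares different positions only, so a class extending itself is not
      -- excluded. Redirecting an optional requirement would then lead back to the removed class
      -- `L`, and the case is settled directly.
      · by_cases hself : r.IsOptional ∧ L.super = L.name
        · exact valid_of_self_super hn hL he hself.1 hm hself.2
        obtain ⟨c', hr', hc'⟩ := exists_mem_removeClass_super hS'.1 hr hc he hi hm
        refine valid_of_super hn hL he hi hm (next hr' hc' fun hopt' L' hL' hname => ?_)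
        rw [isOptional_withRecv] at hopt'
        rw [recv_withRecv] at hname
        have hname := ClassType.name.inj hname
        -- The new receiver `L.super` is not among the removed classes: for `pre` by the removal
        -- order, for `L` by the case distinction on `hself`.
        rcases List.mem_append.1 hL' with h | h
        · exact (List.pairwise_append.1 ho).2.2 L' h L (by simp) hname
        · rw [List.mem_singleton.1 h] at hname
          exact hself ⟨hopt', hname⟩
      · cases r with
        | ext T T' =>
          exact ⟨L.name, L.super, he, by simpa [types] using removeClass_ext hS'.1 hr he,
            ext_mem_classTable.2 ⟨L, hL, rfl, rfl⟩⟩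
        | ctor => exact (hm (L.ctor.params.map Prod.fst) (by simp [member, ClassDecl.members])).elim
        | _ => exact (hi trivial).elim
    · obtain ⟨c', hr', hc'⟩ := exists_mem_removeClass_of_ne hS'.1 hr hc he
      refine next hr' hc' fun h L' hL' => ?_
      rcases List.mem_append.1 hL' with h' | h'
      · exact hopt h L' h'
      · rwa [List.mem_singleton.1 h']

/-! ## Soundness of the co-contextual rules -/

section Soundness

variable {CT : ClassTable} {σ : Subst}

/-- The `zip` in `subConstraints` truncates silently; the equation `hl` guarantees that every
argument is constrained. -/
theorem forall₂_of_subConstraints {Sig : ClassName → ClassName → Prop} {Ts : List ClassType}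
    {Us : List ClassVar} {Cs Ds : List ClassName}
    (hS : Solves Sig σ (subConstraints Ts (Us.map .var)))
    (hT : Ts.map (ClassType.subst σ) = Cs.map .name) (hU : Us.map σ = Ds.map .name)
    (hl : Us.length = Ts.length) : List.Forall₂ (Subtype Sig) Cs Ds := by
  have hlC : Ts.length = Cs.length := by simpa using congrArg List.length hT
  have hlD : Us.length = Ds.length := by simpa using congrArg List.length hU
  rw [List.forall₂_iff_get]
  refine ⟨by omega, fun i hi hj => ?_⟩
  have hTi : (Ts[i]'(by omega)).subst σ = .name Cs[i] := by
    have := congrArg (·[i]?) hT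
    simpa [List.getElem?_eq_getElem (show i < Ts.length by omega), hi] using this
  have hUi : σ (Us[i]'(by omega)) = .name Ds[i] := by
    have := congrArg (·[i]?) hU
    simpa [List.getElem?_eq_getElem (show i < Us.length by omega), hj] using this
  have hsub := hS (.sub (Ts[i]'(by omega)) (.var (Us[i]'(by omega))))
    ⟨(Ts[i]'(by omega), .var (Us[i]'(by omega))), List.mem_iff_getElem.2
      ⟨i, by simp; omega, by simp⟩, rfl⟩
  obtain ⟨C, D, hC, hD, h⟩ := hsub
  obtain rfl := ClassType.name.inj (hTi.symm.trans hC)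
  obtain rfl := ClassType.name.inj (hUi.symm.trans hD)
  exact h

theorem CoExprs.length_eq {es : List Expr} {Ts : List ClassType} {S : Set Constraint}
    {Rs : List CtxReqs} {CRs : List ClassReqs} {X : Set ClassVar}
    (h : CoExprs es Ts S Rs CRs X) : Ts.length = es.length := by
  induction es generalizing Ts S Rs CRs X with
  | nil => cases h; rfl
  | cons e es ih => cases h with | cons _ h _ => simp [ih h]

theorem TypeSubtype.of_names {Sig : ClassName → ClassName → Prop} {C D : ClassName}
    (h : TypeSubtype Sig (.name C) (.name D)) : Subtype Sig C D := by
  obtain ⟨_, _, ⟨⟩, ⟨⟩, h⟩ := h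
  exact h

/-- Coverage is proved in the same induction because splitting a merge at a compound expression
needs it for the subexpressions. -/
theorem CoExpr.sound {Γ : Ctx} {e : Expr} {T : ClassType} {S : Set Constraint} {R : CtxReqs}
    {CR : ClassReqs} {X : Set ClassVar} (h : CoExpr e T S R CR X) :
    Covered σ CR ∧ (Solves (projExt CT) σ S → ReqsValid CT σ CR → R.Meets σ Γ →
      ∃ C, T.subst σ = .name C ∧ HasType Γ CT e C) := by
  refine CoExpr.rec
    (motive_1 := fun e T S R CR _ _ => Covered σ CR ∧ (Solves (projExt CT) σ S →
      ReqsValid CT σ CR → R.Meets σ Γ → ∃ C, T.subst σ = .name C ∧ HasType Γ CT e C))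
    (motive_2 := fun es Ts S Rs CRs _ _ => (∀ CR ∈ CRs, Covered σ CR) ∧
      (Solves (projExt CT) σ S → (∀ CR ∈ CRs, ReqsValid CT σ CR) →
      (∀ R ∈ Rs, R.Meets σ Γ) →
        ∃ Cs, Ts.map (ClassType.subst σ) = Cs.map .name ∧ HasTypes Γ CT es Cs))
    ?_ ?_ ?_ ?_ ?_ ?_ ?_ ?_ ?_ h
  case refine_1 =>
    refine fun x U => ⟨covered_empty σ, fun _ _ hR => ?_⟩
    obtain ⟨C, hC, hU⟩ := hR x (.var U) (by simp [CtxReqs.single])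
    exact ⟨C, hU, .var hC⟩
  case refine_2 =>
    rintro e f Te Se Re CRe X U CR Sf - - heq ⟨hcov, ih⟩
    obtain ⟨rfl, rfl⟩ := Prod.mk.inj heq
    refine ⟨hcov.mergeCR (covered_singleton σ _), fun hS hCR hR => ?_⟩
    obtain ⟨hSe, hSf⟩ := solves_union.1 hS
    obtain ⟨hCRe, hf⟩ := ReqsValid.of_mergeCR hcov (covered_singleton σ _) hSf hCR
    obtain ⟨C, hC, hty⟩ := ih hSe hCRe hR
    obtain ⟨C', D, hC', hD, hl⟩ := hf _ _ rfl (condHolds_empty σ)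
    obtain rfl := ClassType.name.inj (hC.symm.trans hC')
    exact ⟨D, (List.cons.inj hD).1, .field hty hl⟩
  case refine_3 =>
    rintro e m es Te Se Re CRe Xe Ts Ss Rs CRs Xs Us U' R' Sr CR' Scr - hes - hlen - - hRs hCRs
      ⟨hcov, ih⟩ ⟨hcovs, ihs⟩
    obtain ⟨rfl, rfl⟩ := Prod.ext_iff.1 hRs
    obtain ⟨rfl, rfl⟩ := Prod.ext_iff.1 hCRs
    have hcov' := List.forall_mem_cons.2 ⟨hcov, List.forall_mem_cons.2
      ⟨covered_singleton σ (.method Te m (Us.map .var) (.var U')), hcovs⟩⟩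
    refine ⟨covered_mergeCRs hcov', fun hS hCR hR => ?_⟩
    simp only [solves_union] at hS
    obtain ⟨⟨⟨⟨hSs, hSe⟩, hsub⟩, hSr⟩, hScr⟩ := hS
    have hCR := ReqsValid.of_mergeCRs hcov' hScr hCR
    have hR := CtxReqs.Meets.of_mergeRs hSr hR
    simp only [List.forall_mem_cons] at hCR hR
    obtain ⟨C, hC, hty⟩ := ih hSe hCR.1 hR.1
    obtain ⟨Cs, hCs, htys⟩ := ihs hSs hCR.2.2 hR.2
    obtain ⟨C', Ds, D, hC', hD, hl⟩ := hCR.2.1 _ _ rfl (condHolds_empty σ)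
    obtain rfl := ClassType.name.inj (hC.symm.trans hC')
    obtain ⟨hD, hDs⟩ := List.cons.inj hD
    rw [map_subst_var] at hDs
    exact ⟨D, hD, .invk hty htys hl
      (forall₂_of_subConstraints hsub hCs hDs (hlen.trans hes.length_eq.symm))⟩
  case refine_4 =>
    rintro C es Ts Ss Rs CRs Xs Us R' Sr CR' Scr hes hlen - - hRs hCRs ⟨hcovs, ihs⟩
    obtain ⟨rfl, rfl⟩ := Prod.ext_iff.1 hRs
    obtain ⟨rfl, rfl⟩ := Prod.ext_iff.1 hCRs
    have hcov' := List.forall_mem_cons.2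
      ⟨covered_singleton σ (.ctor (.name C) (Us.map .var)), hcovs⟩
    refine ⟨covered_mergeCRs hcov', fun hS hCR hR => ?_⟩
    simp only [solves_union] at hS
    obtain ⟨⟨⟨hSs, hsub⟩, hSr⟩, hScr⟩ := hS
    have hCR := ReqsValid.of_mergeCRs hcov' hScr hCR
    have hR := CtxReqs.Meets.of_mergeRs hSr hR
    simp only [List.forall_mem_cons] at hCR
    obtain ⟨Cs, hCs, htys⟩ := ihs hSs hCR.2 hR
    obtain ⟨C', Ds, hC', hDs, hl⟩ := hCR.1 _ _ rfl (condHolds_empty σ)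
    obtain rfl := ClassType.name.inj hC'
    rw [ClassReq.types, map_subst_var] at hDs
    exact ⟨C, rfl, .new htys hl
      (forall₂_of_subConstraints hsub hCs hDs (hlen.trans hes.length_eq.symm))⟩
  case refine_5 =>
    rintro C e Te Se Re CRe X - ⟨hcov, ih⟩
    refine ⟨hcov, fun hS hCR hR => ?_⟩
    simp only [solves_union, solves_singleton] at hS
    obtain ⟨D, hD, hty⟩ := ih hS.1 hCR hR
    have hs : TypeSubtype _ (Te.subst σ) (.name C) := hS.2
    rw [hD] at hs
    exact ⟨C, rfl, .upCast hty hs.of_names⟩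
  case refine_6 =>
    rintro C e Te Se Re CRe X - ⟨hcov, ih⟩
    refine ⟨hcov, fun hS hCR hR => ?_⟩
    simp only [solves_union, solves_singleton] at hS
    obtain ⟨⟨hSe, hs⟩, hne⟩ := hS
    obtain ⟨D, hD, hty⟩ := ih hSe hCR hR
    simp only [Constraint.Sat, hD] at hs hne
    exact ⟨C, rfl, .downCast hty hs.of_names fun h => hne (h ▸ rfl)⟩
  case refine_7 =>
    rintro C e Te Se Re CRe X - ⟨hcov, ih⟩
    refine ⟨hcov, fun hS hCR hR => ?_⟩
    simp only [solves_union, solves_singleton] at hS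
    obtain ⟨⟨hSe, hs⟩, hs'⟩ := hS
    obtain ⟨D, hD, hty⟩ := ih hSe hCR hR
    rw [Constraint.Sat, hD] at hs hs'
    exact ⟨C, rfl, .stupidCast hty (fun h => hs ⟨C, D, rfl, rfl, h⟩)
      fun h => hs' ⟨D, C, rfl, rfl, h⟩⟩
  case refine_8 => exact ⟨by simp, fun _ _ _ => ⟨[], rfl, .nil⟩⟩
  case refine_9 =>
    rintro e T S R CR X es Ts Ss Rs CRs Xs - - - ⟨hcov, ih⟩ ⟨hcovs, ihs⟩
    refine ⟨List.forall_mem_cons.2 ⟨hcov, hcovs⟩, fun hS hCR hR => ?_⟩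
    rw [List.forall_mem_cons] at hCR hR
    obtain ⟨hS, hSs⟩ := solves_union.1 hS
    obtain ⟨C, hC, hty⟩ := ih hS hCR.1 hR.1
    obtain ⟨Cs, hCs, htys⟩ := ihs hSs hCR.2 hR.2
    exact ⟨C :: Cs, by simp [hC, hCs], .cons hty htys⟩

theorem CtxReqs.foldl_remove (params : List (ClassName × ParamName)) (R : CtxReqs) (x : ParamName)
    (hx : ∀ p ∈ params, p.2 ≠ x) :
    params.foldl (fun R p => R.remove (.param p.2)) R (.param x) = R (.param x) := by
  induction params generalizing R with
  | nil => rfl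
  | cons p params ih =>
    rw [List.forall_mem_cons] at hx
    rw [List.foldl_cons, ih _ hx.2]
    simp [CtxReqs.remove, Function.update, hx.1.symm]

theorem CtxReqs.meets_methodCtx {Sig : ClassName → ClassName → Prop} {C : ClassName}
    {params : List (ClassName × ParamName)} {R : CtxReqs} {U : ClassVar}
    (hU : σ U = .name C) (hthis : Solves Sig σ (thisConstraints U R))
    (hparams : Solves Sig σ (paramConstraints params R))
    (hR : params.foldl (fun R p => R.remove (.param p.2)) (R.remove .this) = CtxReqs.empty) :
    R.Meets σ (methodCtx C params) := by
  rintro (_ | x) T hx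
  · have : σ U = T.subst σ := hthis _ ⟨T, hx, rfl⟩
    exact ⟨C, rfl, this ▸ hU⟩
  · cases hf : params.find? fun p => p.2 = x with
    | none =>
      -- An undeclared variable survives the successive deletions, contradicting that nothing is
      -- left.
      have := congrFun hR (.param x)
      rw [CtxReqs.foldl_remove _ _ _ (by simpa using hf)] at this
      simp [CtxReqs.remove, CtxReqs.empty, hx] at this
    | some p =>
      have hp : p.2 = x := by simpa using List.find?_some hf
      have : ClassType.name p.1 = T.subst σ :=
        hparams _ ⟨p, List.mem_of_find?_eq_some hf, T, hp ▸ hx, rfl⟩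
      exact ⟨p.1, by simp [methodCtx, hf], this.symm⟩

/-- The inheritance requirement forces the variable `Ud` to denote the superclass; the optional
requirement on `Ud` then becomes the FJ condition on overriding. -/
theorem CoMethod.sound {M : MethodDecl} {S : Set Constraint} {U : ClassVar} {CR : ClassReqs}
    {X : Set ClassVar} {C : ClassName} (h : CoMethod M S U CR X) :
    Covered σ CR ∧ (σ U = .name C → Solves (projExt CT) σ S → ReqsValid CT σ CR →
      MethodOK C CT M) := by
  obtain ⟨he, -, -, -, hR, hCR⟩ := h
  rename_i Te Se Re CRe X Ud Scr
  obtain ⟨rfl, rfl⟩ := Prod.ext_iff.1 hCR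
  -- Coverage does not involve the typing context, so an arbitrary one is supplied.
  have hcov := List.forall_mem_cons.2 ⟨(he.sound (CT := CT) (Γ := fun _ => none)).1,
    List.forall_mem_cons.2 ⟨covered_singleton σ (.ext (.var U) (.var Ud)), List.forall_mem_cons.2
      ⟨covered_singleton σ (.optMethod (.var Ud) M.name (M.paramTypes.map .name) (.name M.ret)),
        List.forall_mem_nil _⟩⟩⟩
  refine ⟨covered_mergeCRs hcov, fun hU hS hCR => ?_⟩
  simp only [solves_union, solves_singleton] at hS
  obtain ⟨⟨⟨⟨hSe, hret⟩, hthis⟩, hScr⟩, hparams⟩ := hS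
  have hCR := ReqsValid.of_mergeCRs hcov hScr hCR
  simp only [List.forall_mem_cons] at hCR
  obtain ⟨hCRe, hext, hopt, -⟩ := hCR
  obtain ⟨E, hE, hty⟩ := he.sound.2 hSe hCRe (CtxReqs.meets_methodCtx hU hthis hparams hR)
  obtain ⟨C', D, hC, hD, hCD⟩ := hext _ _ rfl (condHolds_empty σ)
  obtain rfl := ClassType.name.inj (hU.symm.trans hC)
  rw [Constraint.Sat, hE] at hret
  refine ⟨E, D, hty, hret.of_names, hCD, fun Ds D₀ hm => ?_⟩
  have := hopt _ _ rfl (condHolds_empty σ) D Ds D₀ (List.cons.inj hD).1 hm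
  obtain ⟨h₁, h₂⟩ := List.cons.inj this
  rw [map_subst_name] at h₂
  exact ⟨map_name_inj h₂, ClassType.name.inj h₁⟩

theorem CoMethods.sound {Ms : List MethodDecl} {S : Set Constraint} {Us : List ClassVar}
    {CRs : List ClassReqs} {X : Set ClassVar} {C : ClassName} (h : CoMethods Ms S Us CRs X) :
    (∀ CR ∈ CRs, Covered σ CR) ∧ ((∀ U ∈ Us, σ U = .name C) → Solves (projExt CT) σ S →
      (∀ CR ∈ CRs, ReqsValid CT σ CR) → ∀ M ∈ Ms, MethodOK C CT M) := by
  induction h with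
  | nil => simp
  | cons hM _ _ ih =>
    have hM := hM.sound (σ := σ) (CT := CT) (C := C)
    simp only [List.forall_mem_cons, solves_union]
    exact ⟨⟨hM.1, ih.1⟩, fun hU hS hCR =>
      ⟨hM.2 hU.1 hS.1 hCR.1, ih.2 hU.2 hS.2 hCR.2⟩⟩

theorem CoClass.sound {L : ClassDecl} {S : Set Constraint} {CR : ClassReqs} {X : Set ClassVar}
    (h : CoClass L S CR X) :
    Covered σ CR ∧ (Solves (projExt CT) σ S → ReqsValid CT σ CR → ClassOK CT L) := by
  obtain ⟨hshape, hMs, hCR⟩ := h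
  rename_i Ds' Ss Us CRs Scr
  obtain ⟨rfl, rfl⟩ := Prod.ext_iff.1 hCR
  have hMs := hMs.sound (σ := σ) (CT := CT) (C := L.name)
  have hcov := List.forall_mem_cons.2
    ⟨covered_singleton σ (.ctor (.name L.super) (Ds'.map .name)), hMs.1⟩
  refine ⟨covered_mergeCRs hcov, fun hS hCR => ?_⟩
  simp only [solves_union] at hS
  have hCR := ReqsValid.of_mergeCRs hcov hS.2 hCR
  rw [List.forall_mem_cons] at hCR
  obtain ⟨C, Ds, hC, hDs, hf⟩ := hCR.1 _ _ rfl (condHolds_empty σ)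
  obtain rfl := ClassType.name.inj hC
  rw [ClassReq.types, map_subst_name] at hDs
  obtain rfl := map_name_inj hDs
  exact ⟨Ds', hshape, hf, hMs.2 (fun U hU => hS.1.2 _ ⟨U, hU, rfl⟩) hS.1.1 hCR.2⟩

theorem CoClasses.sound {Ls : List ClassDecl} {S : Set Constraint} {CRs : List ClassReqs}
    {X : Set ClassVar} (h : CoClasses Ls S CRs X) :
    (∀ CR ∈ CRs, Covered σ CR) ∧ (Solves (projExt CT) σ S →
      (∀ CR ∈ CRs, ReqsValid CT σ CR) → ∀ L ∈ Ls, ClassOK CT L) := by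
  induction h with
  | nil => simp
  | cons hL _ _ ih =>
    have hL := hL.sound (σ := σ) (CT := CT)
    simp only [List.forall_mem_cons, solves_union]
    exact ⟨⟨hL.1, ih.1⟩, fun hS hCR => ⟨hL.2 hS.1 hCR.1, ih.2 hS.2 hCR.2⟩⟩

end Soundness

/-- Identifies the subtyping in which the constraints are solved with the one used by the FJ rules.
-/
theorem projExt_classTable (Ls : List ClassDecl) :
    projExt (classTable Ls) = projExtDecls Ls :=
  funext fun _ => funext fun _ => propext ext_mem_classTable

end CoFJ

theorem mainTheorem8 (Ls : List CoFJ.ClassDecl)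
    (hnames : (Ls.map CoFJ.ClassDecl.name).Nodup)
    (S : Set CoFJ.Constraint) (CR : CoFJ.ClassReqs) (σ : CoFJ.Subst)
    (hco : CoFJ.CoProgramOK σ Ls S CR)
    (hσ : CoFJ.GroundSolution (CoFJ.projExtDecls Ls) S CR σ) :
    CoFJ.ProgramOK Ls := by
  obtain ⟨hLs, hmerge, hperm, hfirst, hrem, hdis⟩ := hco
  obtain ⟨rfl, rfl⟩ := Prod.ext_iff.1 hmerge
  obtain ⟨rfl, rfl⟩ := Prod.ext_iff.1 hrem
  have hS := hσ.1
  rw [CoFJ.solves_union, CoFJ.solves_union, ← CoFJ.projExt_classTable] at hS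
  have hLs := hLs.sound (σ := σ) (CT := CoFJ.classTable Ls)
  refine hLs.2 hS.1.1 (CoFJ.ReqsValid.of_mergeCRs hLs.1 hS.1.2 fun r c hr hc => ?_)
  -- With no class removed yet, the restriction on optional requirements is empty.
  exact CoFJ.ClassReq.valid_of_removed hnames _ [] hperm hfirst _ hS.2 hdis hr hc (by simp)
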